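/- Let $r$ and $d$ be fixed positive integers with $r<d$. Let $(\mathcal T_t)_{t\ge 0}$ be the random $d$-ary recursive tree: $\mathcal T_0$ consists of a single vertex, the root, and for each $t\ge 0$, given $\mathcal T_0,\dots,\mathcal T_t$, the tree $\mathcal T_{t+1}$ is obtained from $\mathcal T_t$ by choosing a vertex without offspring (a leaf) uniformly at random and giving it exactly $d$ new offspring. Let $S_t$ be the number of vertices of a largest $r$-ary subtree of $\mathcal T_t$, that is, a largest connected subgraph of $\mathcal T_t$ in which every vertex has at most $r$ of its offspring. Let $$\delta = 1 - \frac{d-r}{e\,d^{2d}\,\log(11\, d \log d)},$$ where $\log$ is the natural logarithm. Then almost surely there is a (random) finite $N$ such that $S_t < t^{\delta}$ for all $t\ge N$. -/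

import Mathlib

open MeasureTheory Filter

/-- Vertices of the infinite rooted `d`-ary tree: the root is `[]`, and the `d` offspring of
`v` are the lists `i :: v` with `i : Fin d`. -/
abbrev DVertex (d : ℕ) : Type := List (Fin d)

/-- The vertices of the finite tree `A` that have no offspring in `A`. -/
def treeLeaves {d : ℕ} (A : Finset (DVertex d)) : Finset (DVertex d) :=
  A.filter fun v => ∀ i : Fin d, i :: v ∉ A

/-- The tree obtained from `A` by giving `v` all of its `d` offspring. -/
def growAt {d : ℕ} (A : Finset (DVertex d)) (v : DVertex d) : Finset (DVertex d) :=
  A ∪ Finset.univ.image fun i : Fin d => i :: v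

/-- `T` is a random `d`-ary recursive tree: at time `0` it consists of the root only, and,
conditionally on the whole history `T 0, …, T t`, the tree `T (t + 1)` arises from `T t` by
giving `d` offspring to a uniformly random leaf of `T t`. The conditional law is written out
history by history (trees are finite sets of vertices, so there are only countably many). -/
structure IsRandomRecursiveTree (d : ℕ) {Ω : Type*} [MeasurableSpace Ω] (μ : Measure Ω)
    (T : ℕ → Ω → Finset (DVertex d)) : Prop where
  measurable : ∀ (t : ℕ) (A : Finset (DVertex d)), MeasurableSet {ω | T t ω = A}
  zero : ∀ᵐ ω ∂μ, T 0 ω = {[]}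
  step : ∀ (t : ℕ) (h : ℕ → Finset (DVertex d)), ∀ v ∈ treeLeaves (h t),
    μ {ω | (∀ s ≤ t, T s ω = h s) ∧ T (t + 1) ω = growAt (h t) v} =
      μ {ω | ∀ s ≤ t, T s ω = h s} / ((treeLeaves (h t)).card : ENNReal)

/-- `C` is the vertex set of an `r`-ary subtree of the infinite `d`-ary tree: it has a top vertex
`ρ`, the parent of every other vertex of `C` is in `C`, and every vertex has at most `r` of its
offspring in `C`. -/
def IsRarySubtree {d : ℕ} (r : ℕ) (C : Finset (DVertex d)) : Prop :=
  (∃ ρ ∈ C, ∀ u ∈ C, u ≠ ρ → ∃ w ∈ C, ∃ i : Fin d, u = i :: w) ∧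
    ∀ v ∈ C, (Finset.univ.filter fun i : Fin d => i :: v ∈ C).card ≤ r

open Classical in
/-- The number of vertices of a largest `r`-ary subtree of the finite tree `A`. -/
noncomputable def maxRarySubtreeSize {d : ℕ} (r : ℕ) (A : Finset (DVertex d)) : ℕ :=
  (A.powerset.filter fun C => IsRarySubtree r C).sup Finset.card

/-! The offspring trees of the root form a Pólya urn: each holds a share of the leaves and grows
with that probability. An `r`-ary subtree uses at most `r` of them. Each omitted offspring tree
holds at least the fraction `balance` of the leaves, so the used ones hold at most the fraction
`share`, which is `1 - (d - r) * balance`. As `balance` is a martingale of the urn, the mean of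
`share` is a constant `meanShare`, less than one, at all times.

This loss repeats at every level. Given their sizes, the offspring trees are again random recursive
trees, so weighting the leaves below depth `k` with the shares of their ancestors (`pathMass`) gives
mean at most `mass d n * meanShare r d ^ k` (`iterate_stepMean_pathMass_le`). Pathwise,
Cauchy–Schwarz at each level bounds every `r`-ary subtree by `d ^ k + 2 * √(mass * pathMass)`
(`card_le_of_isRooted`). Only first moments of single branches occur, so no independence between
branches is needed.

Markov's inequality at times `2 ^ j`, with `k` proportional to `j`, gives summable probabilities;
Borel–Cantelli and monotonicity in `t` finish. The conditional law enters only through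
`lintegral_eq`, which turns means over the process into iterates of the finite averaging operator
`stepMean`, and through monotonicity. -/

/-! ### Growing trees and the averaging operator of one step -/

/-- Rooted trees in which every vertex has either no offspring or exactly `d` ordered ones. -/
inductive GrowTree (d : ℕ) : Type
  | leaf : GrowTree d
  | node (c : Fin d → GrowTree d) : GrowTree d

namespace GrowTree

variable {d : ℕ}

/-- The number of internal vertices. -/
def splits : GrowTree d → ℕ
  | leaf => 0
  | node c => 1 + ∑ i, (c i).splits

/-- The number of leaves. -/
def leafCount : GrowTree d → ℕ
  | leaf => 1
  | node c => ∑ i, (c i).leafCount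

/-- The sum of `f` over the trees obtained by giving `d` offspring to one leaf. -/
def leafSum {α : Type*} [AddCommMonoid α] : GrowTree d → (GrowTree d → α) → α
  | leaf, f => f (node fun _ => leaf)
  | node c, f => ∑ i, (c i).leafSum fun B => f (node (Function.update c i B))

/-- The mean of `f` after giving `d` offspring to a uniformly random leaf. -/
noncomputable def stepMean {α : Type*} [AddCommMonoid α] [Div α] [NatCast α]
    (f : GrowTree d → α) (B : GrowTree d) : α :=
  B.leafSum f / (B.leafCount : α)

/-- The number of leaves of a tree with `n` internal vertices. -/
def mass (d n : ℕ) : ℝ := 1 + ((d : ℝ) - 1) * n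

/-- Each split trades one leaf for `d`, so the leaf count depends on the number of splits alone and
is deterministic in time. -/
theorem leafCount_eq_mass (B : GrowTree d) : (B.leafCount : ℝ) = mass d B.splits := by
  induction B with
  | leaf => simp [leafCount, splits, mass]
  | node c ih =>
    simp only [leafCount, splits, mass, Nat.cast_sum, ih, Finset.sum_add_distrib, Nat.cast_add,
      Nat.cast_one, ← Finset.mul_sum]
    simp
    ring

theorem mass_pos (hd : 0 < d) (n : ℕ) : 0 < mass d n := by
  have : (1 : ℝ) ≤ d := by exact_mod_cast hd
  have : 0 ≤ ((d : ℝ) - 1) * n := mul_nonneg (by linarith) (by positivity)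
  unfold mass; linarith

theorem leafCount_pos (hd : 0 < d) (B : GrowTree d) : 0 < B.leafCount := by
  have := mass_pos hd B.splits
  rw [← leafCount_eq_mass] at this
  exact_mod_cast this

theorem leafSum_sum {α ι : Type*} [AddCommMonoid α] (B : GrowTree d) (s : Finset ι)
    (f : ι → GrowTree d → α) :
    B.leafSum (fun X => ∑ j ∈ s, f j X) = ∑ j ∈ s, B.leafSum (f j) := by
  induction B generalizing f with
  | leaf => rfl
  | node c ih => simp only [leafSum, ih]; exact Finset.sum_comm

theorem leafSum_const_mul (B : GrowTree d) (a : ℝ) (f : GrowTree d → ℝ) :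
    B.leafSum (fun X => a * f X) = a * B.leafSum f := by
  induction B generalizing f with
  | leaf => rfl
  | node c ih => simp only [leafSum, ih, Finset.mul_sum]

theorem leafSum_mono {α : Type*} [AddCommMonoid α] [PartialOrder α] [IsOrderedAddMonoid α]
    (B : GrowTree d) {f g : GrowTree d → α} (h : ∀ X, f X ≤ g X) : B.leafSum f ≤ B.leafSum g := by
  induction B generalizing f g with
  | leaf => exact h _
  | node c ih => exact Finset.sum_le_sum fun i _ => ih i fun X => h _

theorem leafSum_one (B : GrowTree d) : B.leafSum (fun _ => (1 : ℝ)) = B.leafCount := by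
  induction B with
  | leaf => simp [leafSum, leafCount]
  | node c ih => simp only [leafSum, leafCount, ih, Nat.cast_sum]

theorem ofReal_leafSum (B : GrowTree d) {f : GrowTree d → ℝ} (h : ∀ X, 0 ≤ f X) :
    0 ≤ B.leafSum f ∧ ENNReal.ofReal (B.leafSum f) = B.leafSum fun X => ENNReal.ofReal (f X) := by
  induction B generalizing f with
  | leaf => exact ⟨h _, rfl⟩
  | node c ih =>
    refine ⟨Finset.sum_nonneg fun i _ => (ih i fun X => h _).1, ?_⟩
    simp only [leafSum]
    rw [ENNReal.ofReal_sum_of_nonneg fun i _ => (ih i fun X => h _).1]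
    exact Finset.sum_congr rfl fun i _ => (ih i fun X => h _).2

theorem splits_update (c : Fin d → GrowTree d) (i : Fin d) (B : GrowTree d) :
    (fun j => (Function.update c i B j).splits) =
      Function.update (fun j => (c j).splits) i B.splits := by
  ext j
  by_cases h : j = i
  · subst h; simp
  · simp [h]

/-- Every tree in the sum has exactly one more split than `B`, so a factor depending on the size
comes out. -/
theorem leafSum_splits_mul (B : GrowTree d) (g : ℕ → ℝ) (f : GrowTree d → ℝ) :
    B.leafSum (fun X => g X.splits * f X) = g (B.splits + 1) * B.leafSum f := by
  induction B generalizing f g with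
  | leaf => simp [leafSum, splits]
  | node c ih =>
    simp only [leafSum, Finset.mul_sum]
    refine Finset.sum_congr rfl fun i _ => ?_
    have key : ∀ X : GrowTree d, (node (Function.update c i X)).splits =
        X.splits + (1 + ∑ j ∈ Finset.univ.erase i, (c j).splits) := by
      intro X
      simp only [splits]
      rw [← Finset.add_sum_erase _ _ (Finset.mem_univ i), Function.update_self]
      have : ∑ x ∈ Finset.univ.erase i, (Function.update c i X x).splits =
          ∑ j ∈ Finset.univ.erase i, (c j).splits :=
        Finset.sum_congr rfl fun j hj => by
          rw [Function.update_of_ne (Finset.ne_of_mem_erase hj)]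
      omega
    simp only [key]
    rw [ih i (fun n => g (n + (1 + ∑ j ∈ Finset.univ.erase i, (c j).splits)))]
    have h := key (c i)
    rw [Function.update_eq_self] at h
    rw [h]
    congr 2
    omega

theorem stepMean_mono_real (hd : 0 < d) {f g : GrowTree d → ℝ} (h : ∀ X, f X ≤ g X)
    (B : GrowTree d) : stepMean f B ≤ stepMean g B := by
  have := leafCount_pos hd B
  exact div_le_div_of_nonneg_right (B.leafSum_mono h) (by positivity)

theorem iterate_stepMean_mono_real (hd : 0 < d) (n : ℕ) {f g : GrowTree d → ℝ}
    (h : ∀ X, f X ≤ g X) (B : GrowTree d) : stepMean^[n] f B ≤ stepMean^[n] g B := by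
  induction n generalizing f g with
  | zero => exact h B
  | succ n ih => exact ih (stepMean_mono_real hd h)

theorem iterate_stepMean_mono_ennreal (n : ℕ) {f g : GrowTree d → ENNReal}
    (h : ∀ X, f X ≤ g X) (B : GrowTree d) : stepMean^[n] f B ≤ stepMean^[n] g B := by
  induction n generalizing f g with
  | zero => exact h B
  | succ n ih => exact ih fun X => ENNReal.div_le_div_right (X.leafSum_mono h) _

/-- Integrals over the process live in `ENNReal`, while `share` involves subtraction; this passes
between the two. -/
theorem ofReal_iterate_stepMean (hd : 0 < d) (n : ℕ) {f : GrowTree d → ℝ} (h : ∀ X, 0 ≤ f X)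
    (B : GrowTree d) :
    ENNReal.ofReal (stepMean^[n] f B) = stepMean^[n] (fun X => ENNReal.ofReal (f X)) B := by
  induction n generalizing f with
  | zero => rfl
  | succ n ih =>
    have hs : (fun X => ENNReal.ofReal (stepMean f X)) =
        stepMean fun X => ENNReal.ofReal (f X) := by
      ext X
      have hX : (0 : ℝ) < X.leafCount := by exact_mod_cast leafCount_pos hd X
      rw [stepMean, ENNReal.ofReal_div_of_pos hX, (X.ofReal_leafSum h).2, stepMean,
        ENNReal.ofReal_natCast]
    rw [Function.iterate_succ_apply, Function.iterate_succ_apply, ← hs]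
    exact ih fun X => div_nonneg (X.ofReal_leafSum h).1 (Nat.cast_nonneg _)

theorem iterate_stepMean_sum {ι : Type*} (n : ℕ) (s : Finset ι) (f : ι → GrowTree d → ℝ)
    (B : GrowTree d) :
    stepMean^[n] (fun X => ∑ j ∈ s, f j X) B = ∑ j ∈ s, stepMean^[n] (f j) B := by
  induction n generalizing f with
  | zero => rfl
  | succ n ih =>
    have : stepMean (fun X => ∑ j ∈ s, f j X) = fun X => ∑ j ∈ s, stepMean (f j) X := by
      ext X
      rw [stepMean, leafSum_sum, Finset.sum_div]
      rfl
    rw [Function.iterate_succ_apply, this, ih]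
    rfl

theorem iterate_stepMean_add (n : ℕ) (f g : GrowTree d → ℝ) (B : GrowTree d) :
    stepMean^[n] (fun X => f X + g X) B = stepMean^[n] f B + stepMean^[n] g B := by
  have := iterate_stepMean_sum n Finset.univ (fun b : Bool => bif b then f else g) B
  simpa only [Fintype.sum_bool, cond_true, cond_false] using this

theorem iterate_stepMean_const_mul (n : ℕ) (a : ℝ) (f : GrowTree d → ℝ) (B : GrowTree d) :
    stepMean^[n] (fun X => a * f X) B = a * stepMean^[n] f B := by
  induction n generalizing f with
  | zero => rfl
  | succ n ih =>
    have : stepMean (fun X => a * f X) = fun X => a * stepMean f X := by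
      ext X
      rw [stepMean, leafSum_const_mul, mul_div_assoc]
      rfl
    rw [Function.iterate_succ_apply, this, ih]
    rfl

theorem iterate_stepMean_splits_mul (n : ℕ) (g : ℕ → ℝ) (f : GrowTree d → ℝ) (B : GrowTree d) :
    stepMean^[n] (fun X => g X.splits * f X) B = g (B.splits + n) * stepMean^[n] f B := by
  induction n generalizing f g with
  | zero => rfl
  | succ n ih =>
    have : stepMean (fun X => g X.splits * f X) = fun X => g (X.splits + 1) * stepMean f X := by
      ext X
      rw [stepMean, leafSum_splits_mul, mul_div_assoc]
      rfl
    rw [Function.iterate_succ_apply, this, ih (fun m => g (m + 1))]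
    rfl

theorem iterate_stepMean_one (hd : 0 < d) (n : ℕ) (B : GrowTree d) :
    stepMean^[n] (fun _ => (1 : ℝ)) B = 1 := by
  induction n with
  | zero => rfl
  | succ n ih =>
    have : stepMean (fun _ : GrowTree d => (1 : ℝ)) = fun _ => 1 := by
      ext X
      have := leafCount_pos hd X
      rw [stepMean, leafSum_one, div_self (by positivity)]
    rw [Function.iterate_succ_apply, this, ih]

/-! ### The chain seen from the root -/

/-- A function of the offspring of the root, extended by `0` to the tree without offspring. -/
def onNode (H : (Fin d → GrowTree d) → ℝ) : GrowTree d → ℝ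
  | leaf => 0
  | node c => H c

/-- A root that has split stays split, so the value at `leaf`, in particular the default `0` of
`onNode`, is never seen. -/
theorem iterate_stepMean_onNode_congr (n : ℕ) {f g : GrowTree d → ℝ}
    (h : ∀ c, f (node c) = g (node c)) (c : Fin d → GrowTree d) :
    stepMean^[n] f (node c) = stepMean^[n] g (node c) := by
  induction n generalizing f g with
  | zero => exact h c
  | succ n ih =>
    refine ih fun c => ?_
    simp only [stepMean, leafSum, h]

theorem leafSum_congr_splits (B : GrowTree d) (g : ℕ → ℝ) :
    B.leafSum (fun X => g X.splits) = g (B.splits + 1) * B.leafCount := by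
  have := B.leafSum_splits_mul g fun _ => 1
  simpa only [mul_one, leafSum_one] using this

/-- One step of the chain seen from the root: the offspring tree `i` grows with probability
proportional to its number of leaves. -/
theorem stepMean_onNode (h : (Fin d → ℕ) → ℝ) (F : GrowTree d → ℝ) (j : Fin d)
    (hd : 0 < d) (c : Fin d → GrowTree d) :
    stepMean (onNode fun c => h (fun i => (c i).splits) * F (c j)) (node c) =
      (∑ i ∈ Finset.univ.erase j, (mass d (c i).splits / mass d (1 + ∑ l, (c l).splits)) *
        h (Function.update (fun l => (c l).splits) i ((c i).splits + 1)) * F (c j)) +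
      (mass d (c j).splits / mass d (1 + ∑ l, (c l).splits)) *
        h (Function.update (fun l => (c l).splits) j ((c j).splits + 1)) * stepMean F (c j) := by
  rw [stepMean, leafCount_eq_mass, leafSum, ← Finset.add_sum_erase _ _ (Finset.mem_univ j),
    add_div, add_comm, Finset.sum_div]
  congr 1
  · refine Finset.sum_congr rfl fun i hi => ?_
    have hij := Finset.ne_of_mem_erase hi
    simp only [onNode, splits_update, Function.update_of_ne hij.symm]
    have := (c i).leafSum_congr_splits fun m =>
      h (Function.update (fun l => (c l).splits) i m) * F (c j)
    rw [this, leafCount_eq_mass]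
    simp only [splits]
    ring
  · simp only [onNode, splits_update, Function.update_self]
    have := (c j).leafSum_splits_mul (fun m => h (Function.update (fun l => (c l).splits) j m)) F
    rw [this]
    have h1 := mass_pos hd (c j).splits
    simp only [stepMean, leafCount_eq_mass, splits]
    field_simp

/-- Conditionally on the sizes of the subtrees at the root, each of them is a random tree of its
size. -/
theorem iterate_stepMean_onNode (hd : 0 < d) (n : ℕ) (h : (Fin d → ℕ) → ℝ) (F : GrowTree d → ℝ)
    (j : Fin d) :
    stepMean^[n] (onNode fun c => h (fun i => (c i).splits) * F (c j)) (node fun _ => leaf) =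
      stepMean^[n] (onNode fun c => h (fun i => (c i).splits) *
        stepMean^[(c j).splits] F leaf) (node fun _ => leaf) := by
  induction n generalizing h F with
  | zero => simp [onNode, splits]
  | succ n ih =>
    rw [Function.iterate_succ_apply, Function.iterate_succ_apply]
    -- Condition on the last step: growth in a branch other than `j` only changes the size factor,
    -- while growth in branch `j` also replaces `G` by `stepMean G`. Both outcomes have the shape
    -- required by the induction hypothesis.
    have e1 : ∀ G : GrowTree d → ℝ, stepMean^[n] (stepMean (onNode fun c =>
        h (fun i => (c i).splits) * G (c j))) (node fun _ => leaf) =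
        (∑ i ∈ Finset.univ.erase j, stepMean^[n] (onNode fun c =>
          ((mass d (c i).splits / mass d (1 + ∑ l, (c l).splits)) *
          h (Function.update (fun l => (c l).splits) i ((c i).splits + 1))) * G (c j))
            (node fun _ => leaf)) +
        stepMean^[n] (onNode fun c => ((mass d (c j).splits / mass d (1 + ∑ l, (c l).splits)) *
          h (Function.update (fun l => (c l).splits) j ((c j).splits + 1))) * stepMean G (c j))
            (node fun _ => leaf) := by
      intro G
      rw [← iterate_stepMean_sum, ← iterate_stepMean_add]
      refine iterate_stepMean_onNode_congr n (fun c => ?_) _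
      rw [stepMean_onNode h G j hd c]
      rfl
    have e2 := e1 F
    have e3 := e1 fun B => stepMean^[B.splits] F leaf
    rw [e2, e3]
    congr 1
    · refine Finset.sum_congr rfl fun i _ => ?_
      exact ih (fun x => (mass d (x i) / mass d (1 + ∑ l, x l)) *
        h (Function.update x i (x i + 1))) F
    · rw [ih (fun x => (mass d (x j) / mass d (1 + ∑ l, x l)) *
        h (Function.update x j (x j + 1))) (stepMean F)]
      refine iterate_stepMean_onNode_congr n (fun c => ?_) _
      simp only [onNode]
      congr 1
      -- The averaged function depends on the size only, so one step merely raises the exponent by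
      -- one.
      have : stepMean (fun B : GrowTree d => stepMean^[B.splits] F leaf) (c j) =
          stepMean^[(c j).splits + 1] F leaf := by
        have hp := leafCount_pos hd (c j)
        rw [stepMean, leafSum_congr_splits _ (fun m => stepMean^[m] F leaf)]
        field_simp
      rw [this]
      rfl

/-! ### The Pólya urn at the root and its martingale -/

theorem mass_add (n m : ℕ) : mass d (n + m) = mass d n + ((d : ℝ) - 1) * m := by
  simp only [mass, Nat.cast_add]; ring

theorem mass_mono (hd : 0 < d) {m n : ℕ} (h : m ≤ n) : mass d m ≤ mass d n := by
  obtain ⟨k, rfl⟩ := Nat.exists_eq_add_of_le h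
  have : (1 : ℝ) ≤ d := by exact_mod_cast hd
  rw [mass_add]
  have : 0 ≤ ((d : ℝ) - 1) * k := mul_nonneg (by linarith) (by positivity)
  linarith

theorem sum_mass (x : Fin d → ℕ) : ∑ i, mass d (x i) = mass d (1 + ∑ i, x i) := by
  simp only [mass, Finset.sum_add_distrib, ← Finset.mul_sum, Nat.cast_add, Nat.cast_sum]
  simp
  ring

/-- The balance of a root whose offspring trees have `x i` internal vertices: a martingale of the
chain that bounds the smallest share of an offspring tree from below. -/
noncomputable def balance (x : Fin d → ℕ) : ℝ :=
  (∏ i, mass d (x i)) / ∏ m ∈ Finset.range d, mass d (1 + ∑ i, x i + m)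

theorem balance_nonneg (hd : 0 < d) (x : Fin d → ℕ) : 0 ≤ balance x :=
  div_nonneg (Finset.prod_nonneg fun _ _ => (mass_pos hd _).le)
    (Finset.prod_nonneg fun _ _ => (mass_pos hd _).le)

/-- Bound all factors of the numerator except the one at `i`, and all factors of the denominator, by
the total mass. -/
theorem balance_mul_mass_le (hd : 0 < d) (x : Fin d → ℕ) (i : Fin d) :
    balance x * mass d (1 + ∑ i, x i) ≤ mass d (x i) := by
  set s := 1 + ∑ i, x i with hs
  have hsp := mass_pos hd s
  have hle : ∀ j, mass d (x j) ≤ mass d s := fun j =>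
    mass_mono hd (by have := Finset.single_le_sum (fun i _ => Nat.zero_le (x i))
                      (Finset.mem_univ j); omega)
  have h1 : (∏ j, mass d (x j)) ≤ mass d (x i) * mass d s ^ (d - 1) := by
    rw [← Finset.mul_prod_erase _ _ (Finset.mem_univ i)]
    refine mul_le_mul_of_nonneg_left ?_ (mass_pos hd _).le
    calc ∏ j ∈ Finset.univ.erase i, mass d (x j)
        ≤ ∏ j ∈ Finset.univ.erase i, mass d s :=
          Finset.prod_le_prod (fun _ _ => (mass_pos hd _).le) fun j _ => hle j
      _ = mass d s ^ (d - 1) := by simp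
  have h2 : mass d s ^ d ≤ ∏ m ∈ Finset.range d, mass d (s + m) := by
    calc mass d s ^ d = ∏ m ∈ Finset.range d, mass d s := by simp
      _ ≤ _ := Finset.prod_le_prod (fun _ _ => hsp.le) fun m _ => mass_mono hd (by omega)
  have h3 : mass d s ^ d = mass d s ^ (d - 1) * mass d s := by
    rw [← pow_succ, Nat.sub_add_cancel hd]
  rw [balance, div_mul_eq_mul_div, div_le_iff₀ (lt_of_lt_of_le (by positivity) h2)]
  calc _ ≤ mass d (x i) * mass d s ^ (d - 1) * mass d s :=
        mul_le_mul_of_nonneg_right h1 hsp.le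
    _ = mass d (x i) * mass d s ^ d := by rw [h3]; ring
    _ ≤ _ := mul_le_mul_of_nonneg_left h2 (mass_pos hd _).le

/-- The martingale identity. Growing branch `i` replaces the factor `mass d (x i)` by `mass d (x i +
1)`, and the selection probability cancels the old one. The new factors sum to `mass d (s + d)`,
exactly the factor gained when the denominator shifts by one. -/
theorem sum_mul_balance_update (hd : 0 < d) (x : Fin d → ℕ) :
    ∑ i, mass d (x i) / mass d (1 + ∑ l, x l) * balance (Function.update x i (x i + 1)) =
      balance x := by
  set s := 1 + ∑ i, x i with hs
  have hsp := mass_pos hd s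
  have hup : ∀ i, 1 + ∑ l, Function.update x i (x i + 1) l = s + 1 := by
    intro i
    rw [Finset.sum_update_of_mem (Finset.mem_univ i), hs,
      ← Finset.add_sum_erase _ x (Finset.mem_univ i), Finset.sdiff_singleton_eq_erase]
    omega
  have hnum : ∀ i, mass d (x i) * ∏ l, mass d (Function.update x i (x i + 1) l) =
      mass d (x i + 1) * ∏ l, mass d (x l) := by
    intro i
    rw [← Finset.mul_prod_erase _ _ (Finset.mem_univ i),
      ← Finset.mul_prod_erase _ (fun l => mass d (x l)) (Finset.mem_univ i),
      Function.update_self, Finset.prod_congr rfl fun l hl => by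
        rw [Function.update_of_ne (Finset.ne_of_mem_erase hl)]]
    ring
  have hden : mass d s * ∏ m ∈ Finset.range d, mass d (s + 1 + m) =
      mass d (s + d) * ∏ m ∈ Finset.range d, mass d (s + m) := by
    have h1 := Finset.prod_range_succ (fun m => mass d (s + m)) d
    have h2 := Finset.prod_range_succ' (fun m => mass d (s + m)) d
    simp only [add_zero] at h2
    rw [h1] at h2
    rw [mul_comm, mul_comm (mass d (s + d)), h2]
    simp only [add_assoc, add_comm 1]
  have hsum : ∑ i, mass d (x i + 1) = mass d (s + d) := by
    have h : ∀ i, mass d (x i + 1) = mass d (x i) + ((d : ℝ) - 1) := fun i => by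
      rw [mass_add]; simp
    simp only [h, Finset.sum_add_distrib, sum_mass, mass_add s d]
    simp [hs]; ring
  have hp1 : 0 < ∏ m ∈ Finset.range d, mass d (s + 1 + m) :=
    Finset.prod_pos fun _ _ => mass_pos hd _
  have hp2 : 0 < ∏ m ∈ Finset.range d, mass d (s + m) :=
    Finset.prod_pos fun _ _ => mass_pos hd _
  have hterm : ∀ i, mass d (x i) / mass d s * balance (Function.update x i (x i + 1)) =
      mass d (x i + 1) * ((∏ l, mass d (x l)) /
        (mass d s * ∏ m ∈ Finset.range d, mass d (s + 1 + m))) := by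
    intro i
    rw [balance, hup, div_mul_div_comm, hnum, mul_div_assoc]
  simp only [hterm]
  rw [← Finset.sum_mul, hsum, hden, balance, ← hs]
  have := mass_pos hd (s + d)
  field_simp

theorem iterate_stepMean_balance (hd : 0 < d) (n : ℕ) (c : Fin d → GrowTree d) :
    stepMean^[n] (onNode fun c => balance fun i => (c i).splits) (node c) =
      balance fun i => (c i).splits := by
  induction n generalizing c with
  | zero => rfl
  | succ n ih =>
    rw [Function.iterate_succ_apply]
    refine (iterate_stepMean_onNode_congr n (fun c => ?_) c).trans (ih c)
    have h := stepMean_onNode (balance (d := d)) (fun _ => 1) ⟨0, hd⟩ hd c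
    have h1 : stepMean (fun _ : GrowTree d => (1 : ℝ)) (c ⟨0, hd⟩) = 1 :=
      iterate_stepMean_one hd 1 _
    simp only [mul_one, h1] at h
    rw [h, Finset.sum_erase_add _ _ (Finset.mem_univ _), onNode]
    exact sum_mul_balance_update hd fun i => (c i).splits

/-! ### Shares, and their accumulation over `k` levels -/

/-- A bound for the share of the leaves in any `r` of the offspring trees of the root. -/
noncomputable def share (r : ℕ) (x : Fin d → ℕ) : ℝ := 1 - ((d : ℝ) - r) * balance x

theorem share_nonneg (hd : 0 < d) (r : ℕ) (x : Fin d → ℕ) : 0 ≤ share r x := by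
  have hs := mass_pos hd (1 + ∑ i, x i)
  have h1 : ∑ i : Fin d, balance x * mass d (1 + ∑ i, x i) ≤ ∑ i, mass d (x i) :=
    Finset.sum_le_sum fun i _ => balance_mul_mass_le hd x i
  rw [sum_mass] at h1
  simp only [Finset.sum_const, Finset.card_univ, Fintype.card_fin, nsmul_eq_mul] at h1
  have h2 : (d : ℝ) * balance x ≤ 1 := by
    by_contra h
    nlinarith
  have := mul_nonneg (Nat.cast_nonneg (α := ℝ) r) (balance_nonneg hd x)
  unfold share
  linarith

/-- At least `d - r` branches lie outside `s`, and each holds at least the fraction `balance x` of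
the total. -/
theorem sum_mass_le_share (hd : 0 < d) {r : ℕ} (hrd : r ≤ d) (x : Fin d → ℕ) (s : Finset (Fin d))
    (hs : s.card ≤ r) : ∑ i ∈ s, mass d (x i) ≤ share r x * mass d (1 + ∑ i, x i) := by
  have h1 : ∑ i ∈ sᶜ, balance x * mass d (1 + ∑ i, x i) ≤ ∑ i ∈ sᶜ, mass d (x i) :=
    Finset.sum_le_sum fun i _ => balance_mul_mass_le hd x i
  have h2 := Finset.sum_add_sum_compl s fun i => mass d (x i)
  rw [sum_mass] at h2
  have h3 : ((d : ℝ) - r) ≤ sᶜ.card := by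
    rw [← Nat.cast_sub hrd, Nat.cast_le, Finset.card_compl, Fintype.card_fin]
    omega
  have h4 := mul_le_mul_of_nonneg_right h3
    (mul_nonneg (balance_nonneg hd x) (mass_pos hd (1 + ∑ i, x i)).le)
  rw [Finset.sum_const, nsmul_eq_mul] at h1
  unfold share
  linarith

/-- The numbers of leaves below the vertices at depth `k`, each weighted with the shares of its
ancestors. -/
noncomputable def pathMass (r : ℕ) : ℕ → GrowTree d → ℝ
  | 0, B => B.leafCount
  | _ + 1, leaf => 0
  | k + 1, node c => share r (fun i => (c i).splits) * ∑ i, pathMass r k (c i)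

theorem pathMass_nonneg (hd : 0 < d) (r k : ℕ) (B : GrowTree d) : 0 ≤ pathMass r k B := by
  induction k generalizing B with
  | zero => simp [pathMass]
  | succ k ih =>
    cases B with
    | leaf => simp [pathMass]
    | node c => exact mul_nonneg (share_nonneg hd r _) (Finset.sum_nonneg fun i _ => ih _)

/-- The mean share at the root. -/
noncomputable def meanShare (r d : ℕ) : ℝ := share r fun _ : Fin d => 0

/-- `share` is affine in the martingale `balance`, so its mean keeps its initial value. -/
theorem iterate_stepMean_share (hd : 0 < d) (r n : ℕ) :
    stepMean^[n] (onNode fun c => share r fun i => (c i).splits) (node fun _ : Fin d => leaf) =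
      meanShare r d := by
  have h : stepMean^[n] (onNode fun c => share r fun i => (c i).splits)
      (node fun _ : Fin d => leaf) = stepMean^[n] (fun X : GrowTree d => 1 +
        (-((d : ℝ) - r)) * onNode (fun c => balance fun i => (c i).splits) X)
          (node fun _ => leaf) :=
    iterate_stepMean_onNode_congr n (fun c => by simp only [onNode, share]; ring) _
  rw [h, iterate_stepMean_add, iterate_stepMean_one hd, iterate_stepMean_const_mul,
    iterate_stepMean_balance hd, meanShare, share]
  simp only [splits]
  ring

theorem meanShare_nonneg (hd : 0 < d) (r : ℕ) : 0 ≤ meanShare r d := share_nonneg hd r _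

/-- Conditioning on the sizes at the root, the induction hypothesis replaces each branch by its mass
times `meanShare r d ^ k`. The masses add up to the deterministic total, leaving the mean of a
single `share`. -/
theorem iterate_stepMean_pathMass_le (hd : 0 < d) (r k n : ℕ) :
    stepMean^[n] (pathMass (d := d) r k) leaf ≤ mass d n * meanShare r d ^ k := by
  induction k generalizing n with
  | zero =>
    have h := iterate_stepMean_splits_mul n (mass d) (fun _ => 1) (leaf : GrowTree d)
    simp only [mul_one, iterate_stepMean_one hd, ← leafCount_eq_mass, splits, zero_add] at h
    rw [pow_zero, mul_one, ← h]
    rfl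
  | succ k ih =>
    have hm := meanShare_nonneg hd r
    cases n with
    | zero => exact mul_nonneg (mass_pos hd _).le (pow_nonneg hm _)
    | succ n =>
      have e1 : stepMean^[n + 1] (pathMass (d := d) r (k + 1)) leaf =
          stepMean^[n] (fun X => ∑ j, onNode (fun c => share r (fun i => (c i).splits) *
            pathMass r k (c j)) X) (node fun _ : Fin d => leaf) := by
        -- The outermost operator is the first step in time, and that step is forced: the root
        -- splits.
        rw [Function.iterate_succ_apply', stepMean, leafCount, Nat.cast_one, div_one, leafSum]
        refine iterate_stepMean_onNode_congr n (fun c => ?_) _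
        simp only [onNode, pathMass, Finset.mul_sum]
      rw [e1, iterate_stepMean_sum]
      have e2 : ∀ j : Fin d, stepMean^[n] (onNode (fun c => share r (fun i => (c i).splits) *
            pathMass r k (c j))) (node fun _ : Fin d => leaf) ≤
          stepMean^[n] (onNode (fun c => share r (fun i => (c i).splits) *
            (mass d (c j).splits * meanShare r d ^ k))) (node fun _ : Fin d => leaf) := by
        intro j
        rw [iterate_stepMean_onNode hd n (share r) (pathMass r k) j]
        refine iterate_stepMean_mono_real hd n (fun X => ?_) _
        cases X with
        | leaf => exact le_rfl
        | node c => exact mul_le_mul_of_nonneg_left (ih _) (share_nonneg hd r _)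
      refine (Finset.sum_le_sum fun j _ => e2 j).trans (le_of_eq ?_)
      rw [← iterate_stepMean_sum]
      have e3 := iterate_stepMean_splits_mul n (fun m => meanShare r d ^ k * mass d m)
        (onNode fun c => share r fun i => (c i).splits) (node fun _ : Fin d => leaf)
      rw [iterate_stepMean_share hd] at e3
      refine Eq.trans (iterate_stepMean_onNode_congr n (fun c => ?_) _) (e3.trans ?_)
      · simp only [onNode, splits, ← Finset.mul_sum, ← Finset.sum_mul, sum_mass]
        ring
      · simp only [splits, Finset.sum_const_zero, add_zero, add_comm 1 n]
        ring

/-! ### Trees as vertex sets -/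

/-- The tree whose root has the offspring trees with vertex sets `S i`. -/
def assemble (S : Fin d → Finset (DVertex d)) : Finset (DVertex d) :=
  insert [] (Finset.univ.biUnion fun i => (S i).image (· ++ [i]))

theorem nil_mem_assemble (S : Fin d → Finset (DVertex d)) : [] ∈ assemble S := by simp [assemble]

/-- A vertex lists its path upwards, so the offspring of the root through which it passes is the
last entry. -/
theorem append_mem_assemble (S : Fin d → Finset (DVertex d)) (u : DVertex d) (i : Fin d) :
    u ++ [i] ∈ assemble S ↔ u ∈ S i := by
  simp [assemble]

/-- The vertex set of a tree. -/
def vertices : GrowTree d → Finset (DVertex d)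
  | leaf => {[]}
  | node c => assemble fun i => (c i).vertices

theorem nil_mem_vertices (B : GrowTree d) : [] ∈ B.vertices := by
  cases B with
  | leaf => simp [vertices]
  | node c => exact nil_mem_assemble _

theorem mem_of_cons_mem_vertices (B : GrowTree d) (i : Fin d) (v : DVertex d)
    (h : i :: v ∈ B.vertices) : v ∈ B.vertices := by
  induction B generalizing v with
  | leaf => simp [vertices] at h
  | node c ih =>
    rcases List.eq_nil_or_concat v with rfl | ⟨u, j, rfl⟩
    · exact nil_mem_assemble _
    · rw [List.concat_eq_append] at h ⊢
      rw [vertices, append_mem_assemble]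
      rw [vertices, ← List.cons_append, append_mem_assemble] at h
      exact ih j u h

theorem append_mem_treeLeaves_assemble (S : Fin d → Finset (DVertex d)) (u : DVertex d)
    (i : Fin d) : u ++ [i] ∈ treeLeaves (assemble S) ↔ u ∈ treeLeaves (S i) := by
  simp only [treeLeaves, Finset.mem_filter, ← List.cons_append, append_mem_assemble]

theorem treeLeaves_assemble (hd : 0 < d) (S : Fin d → Finset (DVertex d)) (hS : ∀ i, [] ∈ S i) :
    treeLeaves (assemble S) =
      Finset.univ.biUnion fun i => (treeLeaves (S i)).image (· ++ [i]) := by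
  ext v
  rcases List.eq_nil_or_concat v with rfl | ⟨u, i, rfl⟩
  · have : [] ∉ treeLeaves (assemble S) := by
      simp only [treeLeaves, Finset.mem_filter, not_and, not_forall, not_not]
      exact fun _ => ⟨⟨0, hd⟩, (append_mem_assemble S [] _).2 (hS _)⟩
    simp [this]
  · rw [List.concat_eq_append, append_mem_treeLeaves_assemble]
    simp

theorem mem_growAt {A : Finset (DVertex d)} {v w : DVertex d} :
    w ∈ growAt A v ↔ w ∈ A ∨ ∃ i : Fin d, i :: v = w := by
  simp [growAt]

theorem growAt_assemble (S : Fin d → Finset (DVertex d)) (v : DVertex d) (i : Fin d) :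
    growAt (assemble S) (v ++ [i]) = assemble (Function.update S i (growAt (S i) v)) := by
  ext w
  rcases List.eq_nil_or_concat w with rfl | ⟨u, j, rfl⟩
  · simp [mem_growAt, nil_mem_assemble]
  · rw [List.concat_eq_append, append_mem_assemble, mem_growAt, append_mem_assemble]
    by_cases h : j = i
    · subst h
      rw [Function.update_self, mem_growAt]
      refine or_congr_right (exists_congr fun l => ?_)
      rw [← List.cons_append]
      exact List.append_left_inj _
    · rw [Function.update_of_ne h]
      refine or_iff_left ?_
      rintro ⟨l, hl⟩
      rw [← List.cons_append] at hl
      have := (List.append_inj' hl rfl).2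
      simp at this
      exact h this.symm

/-- The bridge between the two descriptions of growth: a leaf of an assembled tree is a leaf of
exactly one branch, and growing it changes only that branch. -/
theorem sum_treeLeaves_vertices {α : Type*} [AddCommMonoid α] (hd : 0 < d) (B : GrowTree d)
    (g : Finset (DVertex d) → α) :
    ∑ v ∈ treeLeaves B.vertices, g (growAt B.vertices v) = B.leafSum fun X => g X.vertices := by
  induction B generalizing g with
  | leaf =>
    have h1 : treeLeaves (vertices (leaf : GrowTree d)) = {[]} := by
      ext v; simp [treeLeaves, vertices]
    have h2 : growAt (vertices leaf) [] = vertices (node fun _ : Fin d => leaf) := by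
      ext v
      rcases List.eq_nil_or_concat v with rfl | ⟨u, j, rfl⟩
      · simp [growAt, vertices, nil_mem_assemble]
      · rw [List.concat_eq_append, vertices.eq_2, append_mem_assemble]
        rcases u with _ | ⟨a, t⟩ <;> simp [mem_growAt, vertices]
    rw [h1, Finset.sum_singleton, h2]
    rfl
  | node c ih =>
    rw [vertices, treeLeaves_assemble hd _ fun i => nil_mem_vertices _, Finset.sum_biUnion]
    · refine Finset.sum_congr rfl fun i _ => ?_
      rw [Finset.sum_image fun u _ v _ h => List.append_cancel_right h]
      simp only [growAt_assemble]
      rw [ih i fun X => g (assemble (Function.update (fun i => (c i).vertices) i X))]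
      congr 1
      ext X
      rw [vertices]
      congr 2
      ext j
      by_cases h : j = i
      · subst h; simp
      · simp [h]
    · intro i _ j _ hij
      rw [Function.onFun, Finset.disjoint_left]
      rintro _ h1 h2
      simp only [Finset.mem_image] at h1 h2
      obtain ⟨u, -, rfl⟩ := h1
      obtain ⟨v, -, h⟩ := h2
      have := (List.append_inj' h rfl).2
      simp at this
      exact hij this.symm

theorem card_treeLeaves_vertices (hd : 0 < d) (B : GrowTree d) :
    (treeLeaves B.vertices).card = B.leafCount := by
  have h := sum_treeLeaves_vertices (α := ℝ) hd B fun _ => 1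
  rw [leafSum_one, Finset.sum_const, nsmul_eq_mul, mul_one] at h
  exact_mod_cast h

/-- A split adds `d` vertices and `d - 1 ≥ d / 2` leaves. -/
theorem card_vertices_le (hd : 2 ≤ d) (B : GrowTree d) :
    B.vertices.card + 1 ≤ 2 * B.leafCount := by
  induction B with
  | leaf => simp [vertices, leafCount]
  | node c ih =>
    have h1 : (node c).vertices.card ≤ ∑ i, (c i).vertices.card + 1 := by
      rw [vertices, assemble]
      refine (Finset.card_insert_le _ _).trans (Nat.succ_le_succ ?_)
      exact Finset.card_biUnion_le.trans (Finset.sum_le_sum fun i _ => Finset.card_image_le)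
    have h2 : ∑ i, ((c i).vertices.card + 1) ≤ ∑ i, 2 * (c i).leafCount :=
      Finset.sum_le_sum fun i _ => ih i
    rw [Finset.sum_add_distrib, ← Finset.mul_sum] at h2
    simp only [Finset.sum_const, Finset.card_univ, Fintype.card_fin, smul_eq_mul, mul_one] at h2
    rw [leafCount]
    omega

/-! ### Deterministic bound for `r`-ary subtrees -/

/-- A set of vertices, closed under taking parents, in which every vertex has at most `r`
offspring. -/
def IsRooted (r : ℕ) (C : Finset (DVertex d)) : Prop :=
  (∀ (i : Fin d) (v : DVertex d), i :: v ∈ C → v ∈ C) ∧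
    ∀ v, (Finset.univ.filter fun i : Fin d => i :: v ∈ C).card ≤ r

/-- The part of `C` below the offspring `i` of the root. -/
noncomputable def branch (C : Finset (DVertex d)) (i : Fin d) : Finset (DVertex d) :=
  C.preimage (· ++ [i]) fun _ _ _ _ h => List.append_cancel_right h

theorem mem_branch {C : Finset (DVertex d)} {i : Fin d} {u : DVertex d} :
    u ∈ branch C i ↔ u ++ [i] ∈ C :=
  Finset.mem_preimage

theorem IsRooted.branch {r : ℕ} {C : Finset (DVertex d)} (h : IsRooted r C) (i : Fin d) :
    IsRooted r (branch C i) := by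
  refine ⟨fun j v hv => ?_, fun v => ?_⟩
  · rw [mem_branch] at hv ⊢
    exact h.1 j _ hv
  · simpa only [mem_branch, List.cons_append] using h.2 (v ++ [i])

theorem IsRooted.mem_of_append_mem {r : ℕ} {C : Finset (DVertex d)} (h : IsRooted r C)
    {u v : DVertex d} (hu : u ++ v ∈ C) : v ∈ C := by
  induction u with
  | nil => exact hu
  | cons i u ih => exact ih (h.1 i _ hu)

/-- Induct on the number of levels. The branches met by `C` number at most `r`, so by Cauchy–Schwarz
the sum of their square roots is at most the root of (their mass) times (their `pathMass`); the
first factor costs `share`, which is the factor `pathMass` gains. The term `d ^ k` absorbs the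
vertices near the root. -/
theorem card_le_of_isRooted {r : ℕ} (hr : r < d) (hd : 2 ≤ d) (k : ℕ) (B : GrowTree d)
    (C : Finset (DVertex d)) (hC : IsRooted r C) (hCB : C ⊆ B.vertices) :
    (C.card : ℝ) ≤ (d : ℝ) ^ k + 2 * √(mass d B.splits * pathMass r k B) := by
  have hd0 : 0 < d := by omega
  induction k generalizing B C with
  | zero =>
    have h1 : C.card + 1 ≤ 2 * B.leafCount :=
      (Nat.succ_le_succ (Finset.card_le_card hCB)).trans (card_vertices_le hd B)
    have h2 : (C.card : ℝ) + 1 ≤ 2 * B.leafCount := by exact_mod_cast h1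
    rw [pathMass, ← leafCount_eq_mass, Real.sqrt_mul_self (Nat.cast_nonneg _)]
    simp only [pow_zero]
    linarith
  | succ k ih =>
    have hd1 : (1 : ℝ) ≤ d := by exact_mod_cast hd0
    cases B with
    | leaf =>
      have h1 : C.card ≤ 1 := (Finset.card_le_card hCB).trans (by simp [vertices])
      have h2 : (C.card : ℝ) ≤ 1 := by exact_mod_cast h1
      have := one_le_pow₀ hd1 (n := k + 1)
      have := Real.sqrt_nonneg
        (mass d (leaf : GrowTree d).splits * pathMass r (k + 1) (leaf : GrowTree d))
      linarith
    | node c =>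
      set s := Finset.univ.filter fun i : Fin d => [i] ∈ C with hs
      have hscard : s.card ≤ r := hC.2 []
      have hsub : C ⊆ insert [] (s.biUnion fun i => (branch C i).image (· ++ [i])) := by
        intro v hv
        rcases List.eq_nil_or_concat v with rfl | ⟨u, i, rfl⟩
        · simp
        · rw [List.concat_eq_append] at hv ⊢
          refine Finset.mem_insert_of_mem (Finset.mem_biUnion.2 ⟨i, ?_, ?_⟩)
          · simpa [hs] using hC.mem_of_append_mem hv
          · exact Finset.mem_image.2 ⟨u, mem_branch.2 hv, rfl⟩
      have h1 : C.card ≤ ∑ i ∈ s, (branch C i).card + 1 := by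
        refine (Finset.card_le_card hsub).trans ((Finset.card_insert_le _ _).trans ?_)
        exact Nat.succ_le_succ
          (Finset.card_biUnion_le.trans (Finset.sum_le_sum fun i _ => Finset.card_image_le))
      have h2 : (C.card : ℝ) ≤ ∑ i ∈ s, ((branch C i).card : ℝ) + 1 := by
        exact_mod_cast h1
      have h3 : ∑ i ∈ s, ((branch C i).card : ℝ) ≤
          ∑ i ∈ s, ((d : ℝ) ^ k + 2 * √(mass d (c i).splits * pathMass r k (c i))) := by
        refine Finset.sum_le_sum fun i _ => ih (c i) _ (hC.branch i) fun u hu => ?_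
        have := hCB (mem_branch.1 hu)
        rwa [vertices, append_mem_assemble] at this
      rw [Finset.sum_add_distrib, Finset.sum_const, nsmul_eq_mul, ← Finset.mul_sum] at h3
      have hF := fun i => pathMass_nonneg hd0 r k (c i)
      have h4 : ∑ i ∈ s, √(mass d (c i).splits * pathMass r k (c i)) ≤
          √(∑ i ∈ s, mass d (c i).splits) * √(∑ i ∈ s, pathMass r k (c i)) := by
        rw [Finset.sum_congr rfl fun i _ => Real.sqrt_mul (mass_pos hd0 (c i).splits).le _]
        have := Real.sum_sqrt_mul_sqrt_le s (f := fun i => mass d (c i).splits)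
          (g := fun i => pathMass r k (c i)) (fun i => (mass_pos hd0 _).le) hF
        simpa using this
      have h5 : √(∑ i ∈ s, mass d (c i).splits) * √(∑ i ∈ s, pathMass r k (c i)) ≤
          √(mass d (node c).splits * pathMass r (k + 1) (node c)) := by
        rw [← Real.sqrt_mul (Finset.sum_nonneg fun i _ => (mass_pos hd0 _).le)]
        refine Real.sqrt_le_sqrt ?_
        calc _ ≤ (share r (fun i => (c i).splits) * mass d (1 + ∑ i, (c i).splits)) *
                ∑ i, pathMass r k (c i) :=
              mul_le_mul (sum_mass_le_share hd0 hr.le (fun i => (c i).splits) s hscard)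
                (Finset.sum_le_univ_sum_of_nonneg hF) (Finset.sum_nonneg fun i _ => hF i)
                (mul_nonneg (share_nonneg hd0 r _) (mass_pos hd0 _).le)
          _ = _ := by rw [pathMass, splits]; ring
      -- As `s.card ≤ r < d`, there is room for the root itself beside the `s.card` terms `d ^ k`.
      have h6 : (s.card : ℝ) + 1 ≤ d := by exact_mod_cast (by omega : s.card + 1 ≤ d)
      have h7 := one_le_pow₀ hd1 (n := k)
      have h8 : (s.card : ℝ) * (d : ℝ) ^ k + 1 ≤ (d : ℝ) ^ (k + 1) := by
        rw [pow_succ]; nlinarith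
      linarith

/-- Add the path from the top vertex to the root. Each new vertex has only one offspring in the
union, which is allowed because `0 < r`. -/
theorem exists_isRooted_of_isRarySubtree {r : ℕ} (hr : 0 < r) (B : GrowTree d)
    (C : Finset (DVertex d)) (hC : IsRarySubtree r C) (hCB : C ⊆ B.vertices) :
    ∃ C', IsRooted r C' ∧ C ⊆ C' ∧ C' ⊆ B.vertices := by
  obtain ⟨⟨ρ, hρ, hpar⟩, hdeg⟩ := hC
  have hsuf : ∀ n (u : DVertex d), u.length ≤ n → u ∈ C → ρ <:+ u := by
    intro n
    induction n with
    | zero =>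
      intro u hu huC
      by_cases h : u = ρ
      · rw [h]
      · obtain ⟨w, -, i, rfl⟩ := hpar u huC h
        simp at hu
    | succ n ih =>
      intro u hu huC
      by_cases h : u = ρ
      · rw [h]
      · obtain ⟨w, hw, i, rfl⟩ := hpar u huC h
        exact (ih w (by simpa using hu) hw).trans (List.suffix_cons i w)
  have hmem : ∀ w, w ∈ C ∪ ρ.tails.toFinset ↔ w ∈ C ∨ w <:+ ρ := by simp
  have hBsuf : ∀ w u : DVertex d, u ∈ B.vertices → w <:+ u → w ∈ B.vertices := by
    rintro w u hu ⟨t, rfl⟩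
    induction t with
    | nil => exact hu
    | cons i t ih => exact ih (B.mem_of_cons_mem_vertices i _ hu)
  refine ⟨C ∪ ρ.tails.toFinset, ⟨fun i v hv => ?_, fun v => ?_⟩, Finset.subset_union_left, ?_⟩
  · rw [hmem] at hv ⊢
    rcases hv with hv | hv
    · by_cases h : i :: v = ρ
      · right; rw [← h]; exact List.suffix_cons i v
      · obtain ⟨w, hw, j, hj⟩ := hpar _ hv h
        obtain ⟨-, rfl⟩ := List.cons_eq_cons.1 hj
        exact Or.inl hw
    · exact Or.inr ((List.suffix_cons i v).trans hv)
  · simp only [hmem]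
    by_cases hv : v ∈ C
    · refine le_trans (Finset.card_le_card fun i hi => ?_) (hdeg v hv)
      simp only [Finset.mem_filter, Finset.mem_univ, true_and] at hi ⊢
      -- A vertex of `C` lies at or below `ρ`, so its offspring are too deep to be on the added
      -- path.
      refine hi.resolve_right fun h => ?_
      have h1 := h.length_le
      have h2 := (hsuf _ v le_rfl hv).length_le
      simp at h1
      omega
    · refine le_trans (Finset.card_le_one.2 fun i hi j hj => ?_) hr
      have key : ∀ i : Fin d, (i :: v ∈ C ∨ i :: v <:+ ρ) → i :: v <:+ ρ := by
        rintro i (h | h)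
        · by_cases he : i :: v = ρ
          · rw [he]
          · obtain ⟨w, hw, j, hj⟩ := hpar _ h he
            obtain ⟨-, rfl⟩ := List.cons_eq_cons.1 hj
            exact absurd hw hv
        · exact h
      simp only [Finset.mem_filter, Finset.mem_univ, true_and] at hi hj
      have h1 := List.suffix_of_suffix_length_le (key i hi) (key j hj) (by simp)
      have h2 := h1.eq_of_length (by simp)
      exact (List.cons_eq_cons.1 h2).1
  · intro w hw
    rcases (hmem w).1 hw with h | h
    · exact hCB h
    · exact hBsuf w ρ (hCB hρ) h

theorem maxRarySubtreeSize_vertices_le {r : ℕ} (hr : 0 < r) (hrd : r < d) (k : ℕ)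
    (B : GrowTree d) : (maxRarySubtreeSize r B.vertices : ℝ) ≤
      (d : ℝ) ^ k + 2 * √(mass d B.splits * pathMass r k B) := by
  classical
  set b := (d : ℝ) ^ k + 2 * √(mass d B.splits * pathMass r k B)
  have hb : 0 ≤ b := by positivity
  rw [← Nat.le_floor_iff hb, maxRarySubtreeSize]
  refine Finset.sup_le fun C hC => (Nat.le_floor_iff hb).2 ?_
  rw [Finset.mem_filter, Finset.mem_powerset] at hC
  obtain ⟨C', h1, h2, h3⟩ := exists_isRooted_of_isRarySubtree hr B C hC.2 hC.1
  refine le_trans ?_ (card_le_of_isRooted hrd (by omega) k B C' h1 h3)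
  exact_mod_cast Finset.card_le_card h2

end GrowTree

/-! ### From the random process to the averaging operator -/

theorem measure_eq_tsum_inter_fiber {Ω ι : Type*} [MeasurableSpace Ω] [Countable ι]
    (μ : Measure Ω) (X : Ω → ι) (hX : ∀ p, MeasurableSet {ω | X ω = p}) (E : Set Ω)
    (hE : MeasurableSet E) : μ E = ∑' p, μ (E ∩ {ω | X ω = p}) := by
  rw [← measure_iUnion]
  · rw [← Set.inter_iUnion]
    congr 1
    ext ω
    simp
  · intro p q hpq
    rw [Function.onFun, Set.disjoint_left]
    rintro ω ⟨-, h1⟩ ⟨-, h2⟩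
    exact hpq (h1.symm.trans h2)
  · exact fun p => hE.inter (hX p)

theorem lintegral_eq_tsum_fiber {Ω ι : Type*} [MeasurableSpace Ω] [Countable ι]
    (μ : Measure Ω) (X : Ω → ι) (hX : ∀ p, MeasurableSet {ω | X ω = p}) (f : Ω → ENNReal) :
    ∫⁻ ω, f ω ∂μ = ∑' p, ∫⁻ ω in {ω | X ω = p}, f ω ∂μ := by
  rw [← lintegral_iUnion hX]
  · have : (⋃ p, {ω | X ω = p}) = Set.univ := by ext ω; simp
    rw [this, Measure.restrict_univ]
  · intro p q hpq
    rw [Function.onFun, Set.disjoint_left]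
    exact fun ω h1 h2 => hpq (h1.symm.trans h2)

theorem treeLeaves_nonempty {d : ℕ} {A : Finset (DVertex d)} (hA : A.Nonempty) :
    (treeLeaves A).Nonempty := by
  obtain ⟨v, hv, hmax⟩ := A.exists_max_image List.length hA
  refine ⟨v, Finset.mem_filter.2 ⟨hv, fun i hi => ?_⟩⟩
  have := hmax _ hi
  simp at this

/-- The leaf is recovered as the parent of a new vertex; hence growths at distinct leaves are
disjoint events. -/
theorem growAt_injOn {d : ℕ} (hd : 0 < d) {A : Finset (DVertex d)} {v w : DVertex d}
    (hv : v ∈ treeLeaves A) (h : growAt A v = growAt A w) : v = w := by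
  have h1 : (⟨0, hd⟩ : Fin d) :: v ∈ growAt A w := by
    rw [← h]; exact GrowTree.mem_growAt.2 (Or.inr ⟨_, rfl⟩)
  rcases GrowTree.mem_growAt.1 h1 with h2 | ⟨j, hj⟩
  · exact absurd h2 ((Finset.mem_filter.1 hv).2 _)
  · exact (List.cons_eq_cons.1 hj).2.symm

theorem maxRarySubtreeSize_mono {d : ℕ} (r : ℕ) {A A' : Finset (DVertex d)} (h : A ⊆ A') :
    maxRarySubtreeSize r A ≤ maxRarySubtreeSize r A' := by
  classical
  refine Finset.sup_mono fun C hC => ?_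
  rw [Finset.mem_filter, Finset.mem_powerset] at hC ⊢
  exact ⟨hC.1.trans h, hC.2⟩

namespace IsRandomRecursiveTree

variable {d : ℕ} {Ω : Type*} [MeasurableSpace Ω] {μ : Measure Ω}
  {T : ℕ → Ω → Finset (DVertex d)}

/-- Sum the conditional law over the countably many histories; those not ending in `A` contribute
zero. -/
theorem measure_step (hT : IsRandomRecursiveTree d μ T) (t : ℕ) (A : Finset (DVertex d))
    (v : DVertex d) (hv : v ∈ treeLeaves A) :
    μ {ω | T t ω = A ∧ T (t + 1) ω = growAt A v} =
      μ {ω | T t ω = A} / ((treeLeaves A).card : ENNReal) := by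
  have hX : ∀ p : Fin (t + 1) → Finset (DVertex d),
      MeasurableSet {ω | (fun s : Fin (t + 1) => T s ω) = p} := by
    intro p
    have : {ω | (fun s : Fin (t + 1) => T s ω) = p} = ⋂ s : Fin (t + 1), {ω | T s ω = p s} := by
      ext ω
      simp [funext_iff]
    rw [this]
    exact MeasurableSet.iInter fun s => hT.measurable _ _
  rw [measure_eq_tsum_inter_fiber μ _ hX {ω | T t ω = A ∧ T (t + 1) ω = growAt A v}
      ((hT.measurable t A).inter (hT.measurable (t + 1) _)),
    measure_eq_tsum_inter_fiber μ _ hX {ω | T t ω = A} (hT.measurable t A), div_eq_mul_inv,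
    ← ENNReal.tsum_mul_right]
  refine tsum_congr fun p => ?_
  by_cases hp : p (Fin.last t) = A
  -- The value `∅` after time `t` is a dummy: `step` reads the history only up to `t`.
  · set h : ℕ → Finset (DVertex d) := fun s => if hs : s ≤ t then p ⟨s, Nat.lt_succ_of_le hs⟩ else ∅ with hh
    have ht : h t = A := by simpa [hh, Fin.last] using hp
    have hist : ∀ ω, ((fun s : Fin (t + 1) => T s ω) = p) ↔ ∀ s ≤ t, T s ω = h s := by
      intro ω
      rw [funext_iff]
      constructor
      · intro H s hs
        simpa [hh, hs] using H ⟨s, Nat.lt_succ_of_le hs⟩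
      · intro H s
        simpa [hh, Nat.le_of_lt_succ s.2] using H s (Nat.le_of_lt_succ s.2)
    have := hT.step t h v (by rwa [ht])
    rw [ht] at this
    rw [← div_eq_mul_inv]
    convert this using 2
    · ext ω
      simp only [Set.mem_inter_iff, Set.mem_ofPred_eq, hist]
      exact ⟨fun H => ⟨H.2, H.1.2⟩, fun H => ⟨⟨(H.1 t le_rfl).trans ht, H.2⟩, H.1⟩⟩
    · congr 1
      ext ω
      simp only [Set.mem_inter_iff, Set.mem_ofPred_eq, hist]
      exact ⟨fun H => H.2, fun H => ⟨(H t le_rfl).trans ht, H⟩⟩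
  · have hne : ∀ E : Set Ω, E ⊆ {ω | T t ω = A} →
        E ∩ {ω | (fun s : Fin (t + 1) => T s ω) = p} = ∅ := by
      intro E hE
      ext ω
      simp only [Set.mem_inter_iff, Set.mem_ofPred_eq, Set.mem_empty_iff_false, iff_false, not_and]
      rintro h1 rfl
      exact hp (hE h1)
    rw [hne _ fun ω hω => hω.1, hne _ subset_rfl]
    simp

/-- The disjoint growth events have equal measures adding up to that of the fiber, so almost surely
nothing other than growth at a leaf happens. -/
theorem fiber_ae_eq (hT : IsRandomRecursiveTree d μ T) [IsProbabilityMeasure μ] (hd : 0 < d)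
    (t : ℕ) (A : Finset (DVertex d)) (hA : A.Nonempty) :
    (⋃ v ∈ treeLeaves A, {ω | T t ω = A ∧ T (t + 1) ω = growAt A v}) =ᵐ[μ] {ω | T t ω = A} := by
  have hm : ∀ v, MeasurableSet {ω | T t ω = A ∧ T (t + 1) ω = growAt A v} := fun v =>
    (hT.measurable t A).inter (hT.measurable (t + 1) _)
  refine ae_eq_of_subset_of_measure_ge (Set.iUnion₂_subset fun v _ ω hω => hω.1) ?_
    (Finset.measurableSet_biUnion _ fun v _ => hm v).nullMeasurableSet (measure_ne_top _ _)
  rw [measure_biUnion_finset _ fun v _ => hm v]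
  · rw [Finset.sum_congr rfl fun v hv => hT.measure_step t A v hv, Finset.sum_const,
      nsmul_eq_mul, ENNReal.mul_div_cancel]
    · exact Nat.cast_ne_zero.2 (Finset.card_ne_zero.2 (treeLeaves_nonempty hA))
    · exact ENNReal.natCast_ne_top _
  · intro v hv w _ hvw
    rw [Function.onFun, Set.disjoint_left]
    exact fun ω h1 h2 => hvw (growAt_injOn hd hv (h1.2.symm.trans h2.2))

theorem ae_step (hT : IsRandomRecursiveTree d μ T) [IsProbabilityMeasure μ] (hd : 0 < d)
    (t : ℕ) : ∀ᵐ ω ∂μ, (T t ω).Nonempty → ∃ v, T (t + 1) ω = growAt (T t ω) v := by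
  have h : ∀ A : Finset (DVertex d), ∀ᵐ ω ∂μ, A.Nonempty → T t ω = A →
      ∃ v, T (t + 1) ω = growAt A v := by
    intro A
    by_cases hA : A.Nonempty
    · filter_upwards [(hT.fiber_ae_eq hd t A hA).mem_iff] with ω hω _ h
      obtain ⟨v, -, hv⟩ := Set.mem_iUnion₂.1 (hω.2 h)
      exact ⟨v, hv.2⟩
    · exact Eventually.of_forall fun ω h => absurd h hA
  filter_upwards [ae_all_iff.2 h] with ω hω hne
  exact hω _ hne rfl

theorem ae_nonempty (hT : IsRandomRecursiveTree d μ T) [IsProbabilityMeasure μ] (hd : 0 < d)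
    (t : ℕ) : ∀ᵐ ω ∂μ, (T t ω).Nonempty := by
  induction t with
  | zero => filter_upwards [hT.zero] with ω h; simp [h]
  | succ t ih =>
    filter_upwards [ih, hT.ae_step hd t] with ω h1 h2
    obtain ⟨v, hv⟩ := h2 h1
    rw [hv]
    exact h1.mono Finset.subset_union_left

theorem ae_monotone (hT : IsRandomRecursiveTree d μ T) [IsProbabilityMeasure μ] (hd : 0 < d) :
    ∀ᵐ ω ∂μ, Monotone fun t => T t ω := by
  filter_upwards [ae_all_iff.2 (hT.ae_nonempty hd), ae_all_iff.2 (hT.ae_step hd)] with ω h1 h2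
  refine monotone_nat_of_le_succ fun t => ?_
  obtain ⟨v, hv⟩ := h2 t (h1 t)
  rw [hv]
  exact Finset.subset_union_left

theorem lintegral_succ (hT : IsRandomRecursiveTree d μ T) [IsProbabilityMeasure μ] (hd : 0 < d)
    (t : ℕ) (f : Finset (DVertex d) → ENNReal) :
    ∫⁻ ω, f (T (t + 1) ω) ∂μ = ∫⁻ ω, (∑ v ∈ treeLeaves (T t ω), f (growAt (T t ω) v)) /
      ((treeLeaves (T t ω)).card : ENNReal) ∂μ := by
  rw [lintegral_eq_tsum_fiber μ (T t) (hT.measurable t),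
    lintegral_eq_tsum_fiber μ (T t) (hT.measurable t) fun ω =>
      (∑ v ∈ treeLeaves (T t ω), f (growAt (T t ω) v)) / ((treeLeaves (T t ω)).card : ENNReal)]
  refine tsum_congr fun A => ?_
  by_cases hA : A.Nonempty
  · have hm : ∀ v, MeasurableSet {ω | T t ω = A ∧ T (t + 1) ω = growAt A v} := fun v =>
      (hT.measurable t A).inter (hT.measurable (t + 1) _)
    rw [← setLIntegral_congr (hT.fiber_ae_eq hd t A hA),
      lintegral_biUnion_finset _ fun v _ => hm v]
    · have h1 : ∀ v ∈ treeLeaves A,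
          ∫⁻ ω in {ω | T t ω = A ∧ T (t + 1) ω = growAt A v}, f (T (t + 1) ω) ∂μ =
            f (growAt A v) * (μ {ω | T t ω = A} / ((treeLeaves A).card : ENNReal)) := by
        intro v hv
        rw [setLIntegral_congr_fun (g := fun _ => f (growAt A v)) (hm v)
          fun ω hω => by simp only [hω.2], setLIntegral_const, hT.measure_step t A v hv]
      rw [Finset.sum_congr rfl h1, setLIntegral_congr_fun (g := fun _ =>
          (∑ v ∈ treeLeaves A, f (growAt A v)) / ((treeLeaves A).card : ENNReal))
          (hT.measurable t A) fun ω (hω : T t ω = A) => by simp only [hω],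
        setLIntegral_const, ← Finset.sum_mul]
      simp only [div_eq_mul_inv]
      ring
    · intro v hv w _ hvw
      rw [Function.onFun, Set.disjoint_left]
      exact fun ω h1 h2 => hvw (growAt_injOn hd hv (h1.2.symm.trans h2.2))
  · have h0 : μ {ω | T t ω = A} = 0 := by
      have := hT.ae_nonempty hd t
      refine measure_mono_null (fun ω (hω : T t ω = A) => ?_) (ae_iff.1 this)
      rw [← hω] at hA
      exact hA
    rw [setLIntegral_measure_zero _ _ h0, setLIntegral_measure_zero _ _ h0]

theorem lintegral_eq (hT : IsRandomRecursiveTree d μ T) [IsProbabilityMeasure μ] (hd : 0 < d)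
    (t : ℕ) (f : Finset (DVertex d) → ENNReal) :
    ∫⁻ ω, f (T t ω) ∂μ =
      GrowTree.stepMean^[t] (fun X => f X.vertices) (GrowTree.leaf : GrowTree d) := by
  induction t generalizing f with
  | zero =>
    have : ∀ᵐ ω ∂μ, f (T 0 ω) = f {[]} := by
      filter_upwards [hT.zero] with ω h
      rw [h]
    rw [lintegral_congr_ae this, lintegral_const, measure_univ, mul_one]
    rfl
  | succ t ih =>
    rw [hT.lintegral_succ hd, ih fun A =>
      (∑ v ∈ treeLeaves A, f (growAt A v)) / ((treeLeaves A).card : ENNReal),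
      Function.iterate_succ_apply]
    refine congrArg (fun F => GrowTree.stepMean^[t] F GrowTree.leaf) (funext fun X => ?_)
    rw [GrowTree.sum_treeLeaves_vertices hd, GrowTree.card_treeLeaves_vertices hd]
    rfl

/-! ### Tail bound at a fixed time -/

/-- Markov's inequality: on this event `√(mass * pathMass)` exceeds `y / 2`, so `g`, the quotient of
the squares, is at least `1`. Its factor `mass` is deterministic, so the mean of `pathMass`
suffices. -/
theorem measure_lt_maxRarySubtreeSize_le (hT : IsRandomRecursiveTree d μ T)
    [IsProbabilityMeasure μ] {r : ℕ} (hr : 0 < r) (hrd : r < d) (n k : ℕ) {y : ℝ} (hy : 0 < y) :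
    μ {ω | (d : ℝ) ^ k + y < maxRarySubtreeSize r (T n ω)} ≤
      ENNReal.ofReal (4 * GrowTree.mass d n ^ 2 * GrowTree.meanShare r d ^ k / y ^ 2) := by
  classical
  have hd : 0 < d := by omega
  set f : Finset (DVertex d) → ENNReal := fun A =>
    if (d : ℝ) ^ k + y < maxRarySubtreeSize r A then 1 else 0 with hf
  set g : GrowTree d → ℝ := fun X =>
    (4 * GrowTree.mass d X.splits / y ^ 2) * GrowTree.pathMass r k X with hg
  have hE : MeasurableSet {ω | (d : ℝ) ^ k + y < maxRarySubtreeSize r (T n ω)} := by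
    have : {ω | (d : ℝ) ^ k + y < maxRarySubtreeSize r (T n ω)} =
        ⋃ A ∈ {A : Finset (DVertex d) | (d : ℝ) ^ k + y < maxRarySubtreeSize r A},
          {ω | T n ω = A} := by
      ext ω; simp
    rw [this]
    exact MeasurableSet.biUnion (Set.to_countable _) fun A _ => hT.measurable n A
  have hg0 : ∀ X, 0 ≤ g X := fun X =>
    mul_nonneg (div_nonneg (mul_nonneg (by norm_num) (GrowTree.mass_pos hd _).le) (sq_nonneg _))
      (GrowTree.pathMass_nonneg hd r k X)
  have hfg : ∀ X : GrowTree d, f X.vertices ≤ ENNReal.ofReal (g X) := by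
    intro X
    simp only [hf]
    split_ifs with h
    · rw [← ENNReal.ofReal_one]
      refine ENNReal.ofReal_le_ofReal ?_
      have h1 := GrowTree.maxRarySubtreeSize_vertices_le hr hrd k X
      have h2 : y / 2 < √(GrowTree.mass d X.splits * GrowTree.pathMass r k X) := by linarith
      have h3 := (Real.lt_sqrt (by positivity)).1 h2
      have h4 : g X = 4 * (GrowTree.mass d X.splits * GrowTree.pathMass r k X) / y ^ 2 := by
        simp only [hg]; ring
      rw [h4, one_le_div (by positivity)]
      linarith
    · exact zero_le
  have h1 : μ {ω | (d : ℝ) ^ k + y < maxRarySubtreeSize r (T n ω)} = ∫⁻ ω, f (T n ω) ∂μ := by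
    rw [← lintegral_indicator_one hE]
    refine lintegral_congr fun ω => ?_
    simp [hf, Set.indicator_apply]
  rw [h1, hT.lintegral_eq hd]
  refine (GrowTree.iterate_stepMean_mono_ennreal n hfg _).trans ?_
  rw [← GrowTree.ofReal_iterate_stepMean hd n hg0]
  refine ENNReal.ofReal_le_ofReal ?_
  rw [hg, GrowTree.iterate_stepMean_splits_mul n (fun m => 4 * GrowTree.mass d m / y ^ 2)]
  simp only [GrowTree.splits, zero_add]
  have h2 := GrowTree.iterate_stepMean_pathMass_le hd r k n
  have h3 := GrowTree.mass_pos hd n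
  calc _ ≤ 4 * GrowTree.mass d n / y ^ 2 *
        (GrowTree.mass d n * GrowTree.meanShare r d ^ k) :=
        mul_le_mul_of_nonneg_left h2 (by positivity)
    _ = _ := by ring

end IsRandomRecursiveTree

/-! ### Numerical bound for the mean share -/

namespace GrowTree

/-- Since `mass d (1 + m) ≤ d * (m + 1)`, the product is at most `d ^ d * d! ≤ d ^ (2 * d - 1)`; the
spare factor `d` pays for the `2`. -/
theorem two_mul_prod_mass_le {d : ℕ} (hd : 2 ≤ d) :
    2 * ∏ m ∈ Finset.range d, mass d (1 + m) ≤ (d : ℝ) ^ (2 * d) := by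
  obtain ⟨e, rfl⟩ : ∃ e, d = e + 1 := ⟨d - 1, by omega⟩
  have h1 : ∏ m ∈ Finset.range (e + 1), mass (e + 1) (1 + m) ≤
      ∏ m ∈ Finset.range (e + 1), ((e + 1 : ℕ) : ℝ) * ((m : ℝ) + 1) := by
    refine Finset.prod_le_prod (fun _ _ => (mass_pos (by omega) _).le) fun m _ => ?_
    have : (0 : ℝ) ≤ m := Nat.cast_nonneg m
    simp only [mass, Nat.cast_add, Nat.cast_one]
    linarith
  have h2 : ∏ m ∈ Finset.range e, (((m + 1 : ℕ) : ℝ) + 1) ≤ ((e + 1 : ℕ) : ℝ) ^ e := by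
    calc _ ≤ ∏ m ∈ Finset.range e, ((e + 1 : ℕ) : ℝ) := by
          refine Finset.prod_le_prod (fun _ _ => by positivity) fun m hm => ?_
          have := Finset.mem_range.1 hm
          exact_mod_cast (by omega : m + 1 + 1 ≤ e + 1)
      _ = _ := by simp
  rw [Finset.prod_mul_distrib, Finset.prod_const, Finset.card_range,
    Finset.prod_range_succ' (fun m : ℕ => (m : ℝ) + 1)] at h1
  simp only [Nat.cast_zero, zero_add, mul_one] at h1
  have h3 : (2 : ℝ) ≤ ((e + 1 : ℕ) : ℝ) := by exact_mod_cast hd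
  have h4 : (0 : ℝ) < ((e + 1 : ℕ) : ℝ) := by linarith
  calc _ ≤ ((e + 1 : ℕ) : ℝ) * (((e + 1 : ℕ) : ℝ) ^ (e + 1) * ((e + 1 : ℕ) : ℝ) ^ e) := by
        refine mul_le_mul h3 (h1.trans (mul_le_mul_of_nonneg_left h2 (by positivity)))
          (Finset.prod_nonneg fun _ _ => (mass_pos (by omega) _).le) h4.le
    _ = _ := by ring

theorem meanShare_le_exp {r d : ℕ} (hrd : r < d) (hd : 2 ≤ d) :
    meanShare r d ≤ Real.exp (-(2 * ((d : ℝ) - r) / (d : ℝ) ^ (2 * d))) := by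
  have hp : 0 < ∏ m ∈ Finset.range d, mass d (1 + m) :=
    Finset.prod_pos fun _ _ => mass_pos (by omega) _
  have h1 : balance (fun _ : Fin d => 0) = 1 / ∏ m ∈ Finset.range d, mass d (1 + m) := by
    simp [balance, mass]
  have h2 : 2 / (d : ℝ) ^ (2 * d) ≤ balance (fun _ : Fin d => 0) := by
    rw [h1, div_le_div_iff₀ (by positivity) hp, one_mul]
    exact two_mul_prod_mass_le hd
  have h3 : (0 : ℝ) < (d : ℝ) - r := sub_pos.2 (by exact_mod_cast hrd)
  have h4 := mul_le_mul_of_nonneg_left h2 h3.le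
  have h5 := Real.add_one_le_exp (-(2 * ((d : ℝ) - r) / (d : ℝ) ^ (2 * d)))
  have h6 : ((d : ℝ) - r) * (2 / (d : ℝ) ^ (2 * d)) = 2 * ((d : ℝ) - r) / (d : ℝ) ^ (2 * d) := by
    ring
  rw [meanShare, share]
  linarith

end GrowTree

/-! ### Borel–Cantelli along powers of two, and interpolation -/

/-- Along powers of two, the largest `r`-ary subtrees have exponent `δ` almost surely. -/
theorem IsRandomRecursiveTree.ae_eventually_le {r d : ℕ} (hr : 0 < r) (hrd : r < d)
    {Ω : Type*} [MeasurableSpace Ω] {μ : Measure Ω} [IsProbabilityMeasure μ]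
    {T : ℕ → Ω → Finset (DVertex d)} (hT : IsRandomRecursiveTree d μ T) {η : ℝ}
    (hη : 4 * η * Real.log d < 2 * ((d : ℝ) - r) / (d : ℝ) ^ (2 * d)) :
    ∀ᵐ ω ∂μ, ∀ᶠ j : ℕ in atTop, (maxRarySubtreeSize r (T (2 ^ j) ω) : ℝ) ≤
      (2 : ℝ) ^ ((j : ℝ) / 2) + (2 : ℝ) ^ ((j : ℝ) * (1 - η)) / 4 := by
  set b := 2 * ((d : ℝ) - r) / (d : ℝ) ^ (2 * d) with hb
  have hd : 2 ≤ d := by omega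
  have hd2 : (2 : ℝ) ≤ d := by exact_mod_cast hd
  have hlog : 0 < Real.log d := Real.log_pos (by linarith)
  have hl2 : 0 < Real.log 2 := Real.log_pos (by norm_num)
  have hb0 : 0 ≤ b := by
    have : (r : ℝ) ≤ d := by exact_mod_cast hrd.le
    have : 0 ≤ (d : ℝ) - r := by linarith
    positivity
  -- Chosen so that `d ^ (κ * j) = 2 ^ (j / 2)`: the top `k` levels then cost only about the square
  -- root of the time.
  set κ := Real.log 2 / (2 * Real.log d) with hκ
  have hκ0 : 0 < κ := by positivity
  set x := Real.exp (2 * Real.log 2 * η - b * κ) with hx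
  -- With this `κ`, negativity of the exponent is exactly the hypothesis `hη`.
  have hx1 : x < 1 := by
    rw [hx, Real.exp_lt_one_iff, hκ, sub_neg, mul_div_assoc', lt_div_iff₀ (by positivity)]
    nlinarith
  set y : ℕ → ℝ := fun j => (2 : ℝ) ^ ((j : ℝ) * (1 - η)) / 4 with hy
  set k : ℕ → ℕ := fun j => ⌊κ * j⌋₊ with hk
  have hbound : ∀ j : ℕ, 4 * GrowTree.mass d (2 ^ j) ^ 2 * GrowTree.meanShare r d ^ k j / y j ^ 2 ≤
      64 * (d : ℝ) ^ 2 * Real.exp b * x ^ j := by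
    intro j
    have h2j : (1 : ℝ) ≤ 2 ^ j := one_le_pow₀ (by norm_num)
    have hmass : GrowTree.mass d (2 ^ j) ≤ d * Real.exp (j * Real.log 2) := by
      rw [Real.exp_nat_mul, Real.exp_log (by norm_num)]
      simp only [GrowTree.mass, Nat.cast_pow, Nat.cast_ofNat]
      linarith
    -- The floor in `k` loses at most one factor, whence the extra `exp b`.
    have hshare : GrowTree.meanShare r d ^ k j ≤ Real.exp (b - b * κ * j) := by
      calc _ ≤ Real.exp (-b) ^ k j :=
            pow_le_pow_left₀ (GrowTree.meanShare_nonneg (by omega) r)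
              (GrowTree.meanShare_le_exp hrd hd) _
        _ = Real.exp (k j * (-b)) := (Real.exp_nat_mul _ _).symm
        _ ≤ _ := by
            refine Real.exp_le_exp.2 ?_
            have := (Nat.lt_floor_add_one (κ * (j : ℝ))).le
            have := mul_le_mul_of_nonneg_left this hb0
            simp only [hk]
            linarith
    have hyj : y j ^ 2 = Real.exp (2 * (j * (1 - η) * Real.log 2)) / 16 := by
      simp only [hy]
      rw [Real.rpow_def_of_pos (by norm_num), div_pow, ← Real.exp_nat_mul]
      norm_num
      ring_nf
    rw [hyj, div_le_iff₀ (by positivity)]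
    calc _ ≤ 4 * (d * Real.exp (j * Real.log 2)) ^ 2 * Real.exp (b - b * κ * j) :=
          mul_le_mul (mul_le_mul_of_nonneg_left
            (pow_le_pow_left₀ (GrowTree.mass_pos (by omega) _).le hmass 2) (by norm_num)) hshare
            (pow_nonneg (GrowTree.meanShare_nonneg (by omega) r) _) (by positivity)
      _ = 4 * d ^ 2 * (Real.exp (2 * (j * Real.log 2)) * Real.exp (b - b * κ * j)) := by
          rw [mul_pow, ← Real.exp_nat_mul]; push_cast; ring
      _ = 4 * d ^ 2 * (Real.exp b * Real.exp (j * (2 * Real.log 2 * η - b * κ)) *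
            Real.exp (2 * (j * (1 - η) * Real.log 2))) := by
          rw [← Real.exp_add, ← Real.exp_add, ← Real.exp_add]
          ring_nf
      _ = _ := by rw [hx, ← Real.exp_nat_mul]; ring
  have hsum : ∑' j, μ {ω | (d : ℝ) ^ k j + y j < maxRarySubtreeSize r (T (2 ^ j) ω)} ≠ ⊤ := by
    have hs : Summable fun j : ℕ => 64 * (d : ℝ) ^ 2 * Real.exp b * x ^ j :=
      (summable_geometric_of_lt_one (Real.exp_pos _).le hx1).mul_left _
    refine ne_top_of_le_ne_top hs.tsum_ofReal_ne_top (ENNReal.tsum_le_tsum fun j => ?_)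
    exact (hT.measure_lt_maxRarySubtreeSize_le hr hrd (2 ^ j) (k j) (by positivity)).trans
      (ENNReal.ofReal_le_ofReal (hbound j))
  filter_upwards [ae_eventually_notMem hsum] with ω hω
  filter_upwards [hω] with j hj
  refine (not_lt.1 hj).trans (add_le_add_left ?_ _)
  have h1 : (k j : ℝ) ≤ κ * j := Nat.floor_le (by positivity)
  calc (d : ℝ) ^ k j = (d : ℝ) ^ (k j : ℝ) := (Real.rpow_natCast _ _).symm
    _ ≤ (d : ℝ) ^ (κ * j) := Real.rpow_le_rpow_of_exponent_le (by linarith) h1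
    _ = _ := by
      rw [Real.rpow_def_of_pos (by linarith), Real.rpow_def_of_pos (by norm_num), hκ]
      congr 1
      field_simp

theorem mainTheorem6 (r d : ℕ) (hr : 0 < r) (hrd : r < d)
    {Ω : Type*} [MeasurableSpace Ω] (μ : Measure Ω) [IsProbabilityMeasure μ]
    (T : ℕ → Ω → Finset (DVertex d)) (hT : IsRandomRecursiveTree d μ T) :
    ∀ᵐ ω ∂μ, ∀ᶠ t : ℕ in atTop,
      (maxRarySubtreeSize r (T t ω) : ℝ) <
        (t : ℝ) ^ (1 - ((d : ℝ) - (r : ℝ)) /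
          (Real.exp 1 * (d : ℝ) ^ (2 * d) * Real.log (11 * (d : ℝ) * Real.log (d : ℝ)))) := by
  set ℓ := Real.log (11 * (d : ℝ) * Real.log (d : ℝ)) with hℓ
  set η := ((d : ℝ) - (r : ℝ)) / (Real.exp 1 * (d : ℝ) ^ (2 * d) * ℓ) with hηdef
  have hd : 2 ≤ d := by omega
  have hd2 : (2 : ℝ) ≤ d := by exact_mod_cast hd
  have hlog2 := Real.log_two_gt_d9
  have hlog : Real.log 2 ≤ Real.log d := Real.log_le_log (by norm_num) hd2
  have he1 := Real.exp_one_gt_d9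
  have he2 := Real.exp_one_lt_d9
  have hℓ1 : 1 ≤ ℓ := by
    rw [hℓ, Real.le_log_iff_exp_le (by nlinarith)]
    nlinarith
  have hℓd : Real.log d ≤ ℓ := Real.log_le_log (by linarith) (by nlinarith)
  have hgap : (0 : ℝ) < (d : ℝ) - r := sub_pos.2 (by exact_mod_cast hrd)
  have hpow : (d : ℝ) ^ 2 ≤ (d : ℝ) ^ (2 * d) := pow_le_pow_right₀ (by linarith) (by omega)
  have hη0 : 0 ≤ η := by positivity
  have hη4 : η ≤ 1 / 4 := by
    rw [hηdef, div_le_div_iff₀ (by positivity) (by norm_num)]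
    have h1 : 2 * (d : ℝ) ^ 2 ≤ Real.exp 1 * (d : ℝ) ^ (2 * d) :=
      mul_le_mul (by linarith) hpow (by positivity) (by positivity)
    have h2 : 2 * (d : ℝ) ^ 2 * 1 ≤ Real.exp 1 * (d : ℝ) ^ (2 * d) * ℓ :=
      mul_le_mul h1 hℓ1 (by norm_num) (by positivity)
    have h3 : (0 : ℝ) ≤ r := Nat.cast_nonneg r
    nlinarith
  -- The claimed exponent leaves slack: only `2 * log d < e * ℓ` is needed, which follows from `e >
  -- 2` and `ℓ ≥ log d`.
  have hηlt : 4 * η * Real.log d < 2 * ((d : ℝ) - r) / (d : ℝ) ^ (2 * d) := by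
    have h1 : η * (Real.exp 1 * ℓ) = ((d : ℝ) - r) / (d : ℝ) ^ (2 * d) := by
      rw [hηdef]; field_simp
    have h2 : 2 * Real.log d < Real.exp 1 * ℓ := by nlinarith
    have hηpos : 0 < η := by positivity
    have h3 := mul_lt_mul_of_pos_left h2 hηpos
    rw [h1] at h3
    rw [mul_div_assoc]
    linarith
  filter_upwards [hT.ae_eventually_le hr hrd hηlt, hT.ae_monotone (by omega)] with ω h1 hmono
  obtain ⟨J, hJ⟩ := eventually_atTop.1 h1
  -- The `9` serves `hhalf`: with `η ≤ 1 / 4` it needs `(i + 1) / 4 > 2`.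
  filter_upwards [eventually_ge_atTop (2 ^ (J + 9))] with t ht
  have ht0 : t ≠ 0 := by
    have : 0 < 2 ^ (J + 9) := by positivity
    omega
  set i := Nat.log 2 t with hi
  have hi1 : J + 9 ≤ i := Nat.le_log_of_pow_le (by norm_num) ht
  have hi2 : 2 ^ i ≤ t := Nat.pow_log_le_self 2 ht0
  have hi3 : t ≤ 2 ^ (i + 1) := (Nat.lt_pow_succ_log_self (by norm_num) t).le
  have hS : (maxRarySubtreeSize r (T t ω) : ℝ) ≤ maxRarySubtreeSize r (T (2 ^ (i + 1)) ω) := by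
    exact_mod_cast maxRarySubtreeSize_mono r (hmono hi3)
  have hi9 : (9 : ℝ) ≤ i := by exact_mod_cast (by omega : 9 ≤ i)
  have hlow : (2 : ℝ) ^ ((i : ℝ) * (1 - η)) ≤ (t : ℝ) ^ (1 - η) := by
    rw [Real.rpow_mul (by norm_num), Real.rpow_natCast]
    refine Real.rpow_le_rpow (by positivity) (by exact_mod_cast hi2) (by linarith)
  have hup : (2 : ℝ) ^ (((i + 1 : ℕ) : ℝ) * (1 - η)) ≤ 2 * (2 : ℝ) ^ ((i : ℝ) * (1 - η)) := by
    have : (2 : ℝ) * (2 : ℝ) ^ ((i : ℝ) * (1 - η)) = (2 : ℝ) ^ (1 + (i : ℝ) * (1 - η)) := by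
      rw [Real.rpow_add (by norm_num), Real.rpow_one]
    rw [this]
    refine Real.rpow_le_rpow_of_exponent_le (by norm_num) ?_
    push_cast
    linarith
  have hhalf : 4 * (2 : ℝ) ^ (((i + 1 : ℕ) : ℝ) / 2) < (2 : ℝ) ^ (((i + 1 : ℕ) : ℝ) * (1 - η)) := by
    have : (4 : ℝ) * (2 : ℝ) ^ (((i + 1 : ℕ) : ℝ) / 2) =
        (2 : ℝ) ^ (2 + ((i + 1 : ℕ) : ℝ) / 2) := by
      rw [Real.rpow_add (by norm_num)]
      norm_num
    rw [this]
    refine Real.rpow_lt_rpow_of_exponent_lt (by norm_num) ?_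
    push_cast
    nlinarith
  -- Both terms at time `2 ^ (i + 1)` are at most a quarter of `2 ^ ((i + 1) * (1 - η))`, the first
  -- strictly less; together they stay below `2 ^ (i * (1 - η)) ≤ t ^ (1 - η)`.
  have := hJ (i + 1) (by omega)
  linarith
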